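/- **Definitions.** A *vertex algebra* is a complex vector space $V$ with a linear map $u\mapsto Y(u,z)=\sum_{n\in\mathbb Z}u_nz^{-n-1}$, $u_n\in\operatorname{End}V$, such that each $Y(u,z)v$ is a formal Laurent series, and a vacuum vector $\mathbf 1$ with $Y(\mathbf 1,z)=\mathrm{id}_V$ and $Y(u,z)\mathbf 1\in u+zV[[z]]$, satisfying the Jacobi identity: for all $u,v,w\in V$ and $l,m,n\in\mathbb Z$, $$\sum_{i\ge0}(-1)^i\binom li\bigl(u_{m+l-i}v_{n+i}-(-1)^l v_{n+l-i}u_{m+i}\bigr)w=\sum_{i\ge0}\binom mi(u_{l+i}v)_{m+n-i}w .$$ A *vertex operator algebra* $(V,\omega)$ is a vertex algebra $V$ with a vector $\omega\in V$ (the conformal vector) such that, with $L(n)=\omega_{n+1}$: - for some $c\in\mathbb C$ one has $[L(m),L(n)]=(m-n)L(m+n)+\frac{m^3-m}{12}\delta_{m+n,0}\,c$ for all $m,n\in\mathbb Z$; - $Y(L(-1)u,z)=\frac{d}{dz}Y(u,z)$ for all $u\in V$; - $V=\bigoplus_{n\in\mathbb Z}V_n$, where $V_n$ is the $n$-eigenspace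 of $L(0)$, each $V_n$ is finite-dimensional, and $V_n=0$ for all sufficiently negative $n$. A *vertex subalgebra* is a subspace that contains $\mathbf 1$ and is closed under all products $(u,v)\mapsto u_nv$; it is a vertex algebra with the restricted operators. A vector $\omega'\in V$ is a *semi-conformal vector* of $(V,\omega)$ if there is a vertex subalgebra $U\ni\omega'$ of $V$ such that $(U,\omega')$ is a vertex operator algebra and $\omega'_{n+1}u=L(n)u$ for all $n\ge0$ and $u\in U$. Let $\operatorname{Sc}(V,\omega)$ be the set of semi-conformal vectors of $(V,\omega)$. **Theorem 1.1.** For every vertex operator algebra $(V,\omega)$, the set $\operatorname{Sc}(V,\omega)$ is contained in the finite-dimensional space $V_2$ and is Zariski closed in it: in the linear coordinates given by any basis of $V_2$ it is the common zero set of an ideal of $\mathbb C[x_1,\dots,x_d]$, $d=\dim V_2$. Hence $\operatorname{Sc}(V,\omega)$ is an affine algebraic variety (not necessarily irreducible) over $\mathbb C$. -/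

import Mathlib

/-- A vertex algebra structure on a complex vector space `V`: a linear state-field map
`Y : u ↦ Y(u, z) = ∑ₙ uₙ z^(-n-1)`, where each `Y(u, z) v` is a formal Laurent series (so `uₙ v = 0`
for `n` large), a vacuum vector `1`, the vacuum and creation axioms, and the Jacobi identity, written
in components. Here `uₙ` is `VertexOperator.ncoeff (Y u) n`. -/
structure VertexAlgebra (V : Type*) [AddCommGroup V] [Module ℂ V] where
  /-- The state-field correspondence. -/
  Y : V →ₗ[ℂ] VertexOperator ℂ V
  /-- The vacuum vector. -/
  vac : V
  /-- `Y(1, z) = id`. -/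
  vacuum (n : ℤ) (v : V) : VertexOperator.ncoeff (Y vac) n v = if n = -1 then v else 0
  /-- `Y(v, z) 1` is a power series in `z`. -/
  creation_nonneg (v : V) (n : ℤ) (hn : 0 ≤ n) : VertexOperator.ncoeff (Y v) n vac = 0
  /-- `Y(v, z) 1` has constant term `v`. -/
  creation (v : V) : VertexOperator.ncoeff (Y v) (-1) vac = v
  /-- The Jacobi identity in components. All three sums are finite, since every `Y(u, z) v` is a
  Laurent series. -/
  jacobi (u v w : V) (l m n : ℤ) :
    (∑ᶠ i : ℕ, ((-1) ^ i * Ring.choose l i : ℤ) •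
        VertexOperator.ncoeff (Y u) (m + l - i) (VertexOperator.ncoeff (Y v) (n + i) w))
      - (l.negOnePow : ℤ) • (∑ᶠ i : ℕ, ((-1) ^ i * Ring.choose l i : ℤ) •
        VertexOperator.ncoeff (Y v) (n + l - i) (VertexOperator.ncoeff (Y u) (m + i) w))
      = ∑ᶠ i : ℕ, (Ring.choose m i : ℤ) •
        VertexOperator.ncoeff (Y (VertexOperator.ncoeff (Y u) (l + i) v)) (m + n - i) w

namespace VertexAlgebra

variable {V : Type*} [AddCommGroup V] [Module ℂ V]

/-- The `n`-th mode `uₙ` of the vertex operator `Y(u, z) = ∑ₙ uₙ z^(-n-1)`. -/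
noncomputable def mode (A : VertexAlgebra V) (u : V) (n : ℤ) : Module.End ℂ V :=
  VertexOperator.ncoeff (A.Y u) n

/-- The operators `L(n) = ω_(n+1)` attached to a vector `ω`, so `Y(ω, z) = ∑ₙ L(n) z^(-n-2)`. -/
noncomputable def L (A : VertexAlgebra V) (ω : V) (n : ℤ) : Module.End ℂ V :=
  A.mode ω (n + 1)

/-- The eigenspace of `L(0)` (formed with `ω`) for the integer eigenvalue `n`. -/
noncomputable def weightSpace (A : VertexAlgebra V) (ω : V) (n : ℤ) : Submodule ℂ V :=
  (A.L ω 0).eigenspace (n : ℂ)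

/-- `ω` is a conformal vector of the vertex algebra `A`, that is, `(A, ω)` is a vertex operator
algebra: the operators `L(n)` satisfy the Virasoro relations for some central charge, `L(-1)` acts as
the derivative, and the space is `ℤ`-graded by the eigenspaces of `L(0)`, which are
finite-dimensional and vanish in sufficiently negative degrees. -/
structure IsConformalVector (A : VertexAlgebra V) (ω : V) : Prop where
  virasoro : ∃ c : ℂ, ∀ m n : ℤ,
    A.L ω m * A.L ω n - A.L ω n * A.L ω m =
      ((m : ℂ) - (n : ℂ)) • A.L ω (m + n)
        + (if m + n = 0 then ((m : ℂ) ^ 3 - (m : ℂ)) / 12 * c else 0) • (1 : Module.End ℂ V)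
  /-- `Y(L(-1)u, z) = d/dz Y(u, z)`. -/
  derivative : ∀ (u : V) (n : ℤ), A.mode (A.L ω (-1) u) n = (-n : ℂ) • A.mode u (n - 1)
  graded : DirectSum.IsInternal (A.weightSpace ω)
  finite : ∀ n : ℤ, FiniteDimensional ℂ (A.weightSpace ω n)
  bounded : ∃ N : ℤ, ∀ n : ℤ, n < N → A.weightSpace ω n = ⊥

/-- A vertex subalgebra: a subspace containing the vacuum and closed under all products `uₙ v`. -/
structure Subalgebra (A : VertexAlgebra V) extends Submodule ℂ V where
  vac_mem : A.vac ∈ carrier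
  mode_mem : ∀ u ∈ carrier, ∀ v ∈ carrier, ∀ n : ℤ, A.mode u n v ∈ carrier

namespace Subalgebra

variable {A : VertexAlgebra V}

/-- The mode `uₙ` restricted to a subalgebra. -/
noncomputable def modeRestrict (U : A.Subalgebra) (u : U.toSubmodule) (n : ℤ) :
    Module.End ℂ U.toSubmodule :=
  (A.mode u n).restrict fun v hv => U.mode_mem u u.2 v hv n

theorem bddBelow_support (U : A.Subalgebra) (u v : U.toSubmodule) :
    BddBelow (Function.support fun n : ℤ => U.modeRestrict u (-n - 1) v) := by
  refine ⟨HahnSeries.order ((HahnModule.of ℂ).symm (A.Y u v)), fun n hn => ?_⟩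
  by_contra h
  refine hn (Subtype.ext ?_)
  exact VertexOperator.ncoeff_eq_zero_of_lt_order (A.Y u) (-n - 1) v (by omega)

/-- The vertex operator `Y(u, z)` restricted to a subalgebra. -/
noncomputable def YRestrict (U : A.Subalgebra) :
    U.toSubmodule →ₗ[ℂ] VertexOperator ℂ U.toSubmodule where
  toFun u := VertexOperator.of_coeff (fun n => U.modeRestrict u (-n - 1)) (U.bddBelow_support u)
  map_add' u v := by
    refine HVertexOperator.coeff_inj (funext fun n => LinearMap.ext fun w => Subtype.ext ?_)
    simp [VertexOperator.of_coeff, modeRestrict, mode, -VertexOperator.coeff_eq_ncoeff]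
  map_smul' c v := by
    refine HVertexOperator.coeff_inj (funext fun n => LinearMap.ext fun w => Subtype.ext ?_)
    simp [VertexOperator.of_coeff, modeRestrict, mode, -VertexOperator.coeff_eq_ncoeff]

theorem coe_ncoeff_YRestrict (U : A.Subalgebra) (u v : U.toSubmodule) (n : ℤ) :
    ((VertexOperator.ncoeff (U.YRestrict u) n v : U.toSubmodule) : V)
      = VertexOperator.ncoeff (A.Y u) n v := by
  simp [YRestrict, modeRestrict, mode]

/-- A vertex subalgebra, as a vertex algebra with the restricted vertex operators. -/
noncomputable def toVertexAlgebra (U : A.Subalgebra) : VertexAlgebra U.toSubmodule where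
  Y := U.YRestrict
  vac := ⟨A.vac, U.vac_mem⟩
  vacuum n v := by
    refine Subtype.ext ?_
    rw [coe_ncoeff_YRestrict, A.vacuum]
    split_ifs <;> rfl
  creation_nonneg v n hn := Subtype.ext <| by
    rw [coe_ncoeff_YRestrict, A.creation_nonneg _ n hn]; rfl
  creation v := Subtype.ext <| by rw [coe_ncoeff_YRestrict, A.creation]
  jacobi u v w l m n := by
    have key : ∀ f : ℕ → U.toSubmodule, ((∑ᶠ i, f i : U.toSubmodule) : V) = ∑ᶠ i, (f i : V) :=
      fun f => U.toSubmodule.subtype.toAddMonoidHom.map_finsum_of_injective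
        Subtype.val_injective f
    refine Subtype.ext ?_
    simp only [Submodule.coe_sub, Submodule.coe_smul_of_tower, key, coe_ncoeff_YRestrict]
    exact A.jacobi u v w l m n

end Subalgebra

end VertexAlgebra

/-- A vertex operator algebra `(V, ω)`: a vertex algebra with a chosen conformal vector. -/
structure VertexOperatorAlgebra (V : Type*) [AddCommGroup V] [Module ℂ V] extends
    VertexAlgebra V where
  /-- The conformal vector. -/
  ω : V
  conformal : toVertexAlgebra.IsConformalVector ω

namespace VertexOperatorAlgebra

variable {V : Type*} [AddCommGroup V] [Module ℂ V]

/-- The weight space `V_n`, the eigenspace of `L(0)` with eigenvalue `n`. -/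
noncomputable def weightSpace (A : VertexOperatorAlgebra V) (n : ℤ) : Submodule ℂ V :=
  A.toVertexAlgebra.weightSpace A.ω n

/-- `ω'` is a semi-conformal vector of `(V, ω)`: it is the conformal vector of some vertex operator
algebra `(U, ω')` on a vertex subalgebra `U` of `V` such that the inclusion of `U` into `V`
intertwines `L'(n)` on `U` with `L(n)` on `V` for all `n ≥ 0`. -/
def IsSemiConformal (A : VertexOperatorAlgebra V) (ω' : V) : Prop :=
  ∃ (U : A.toVertexAlgebra.Subalgebra) (h : ω' ∈ U.toSubmodule),
    U.toVertexAlgebra.IsConformalVector ⟨ω', h⟩ ∧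
    ∀ n : ℤ, 0 ≤ n → ∀ u : U.toSubmodule,
      ((U.toVertexAlgebra.L ⟨ω', h⟩ n u : U.toSubmodule) : V) =
        A.toVertexAlgebra.L A.ω n (u : V)

/-- The set `Sc(V, ω)` of semi-conformal vectors. -/
def Sc (A : VertexOperatorAlgebra V) : Set V :=
  {ω' | A.IsSemiConformal ω'}

end VertexOperatorAlgebra

/-- A subset of a complex vector space `E` is Zariski closed (an affine algebraic variety in `E`) if
`E` is finite-dimensional and, in the linear coordinates of every basis, the subset is the common
zero set of an ideal of complex polynomials. Irreducibility is not required. -/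
def IsZariskiClosed {E : Type*} [AddCommGroup E] [Module ℂ E] (S : Set E) : Prop :=
  FiniteDimensional ℂ E ∧
    ∀ (d : ℕ) (b : Module.Basis (Fin d) ℂ E), ∃ I : Ideal (MvPolynomial (Fin d) ℂ),
      b.equivFun '' S = MvPolynomial.zeroLocus ℂ I

/-! The subalgebra in the definition of semi-conformality can be eliminated: membership of x in `Sc`
is equivalent to x ∈ V_2 together with x_n x = ω_n x for n ≥ 0, ω_2 x = 0, ω_3 x ∈ ℂ·1 and ω_n x = 0
for n ≥ 4. These equations are quadratic or linear in x, so they cut out a Zariski closed set. They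
are necessary because the Virasoro relations on the vacuum determine the products of a conformal
vector with itself. Conversely, they place x in the commutant U of ω - x, where x_n and ω_n agree
for n ≥ 0. The commutator formula turns the products x_n x into Virasoro relations, and U inherits
the derivative property and the grading from V. -/

/-! ### Eigenspace decompositions of invariant subspaces -/

namespace Module.End

variable {K V : Type*} [Field K] [CharZero K] [AddCommGroup V] [Module K V]

/-- If a sum of eigenvectors with distinct integer eigenvalues lies in an invariant subspace, then so
does each of them. -/
theorem mem_of_sum_eigenvectors_mem (f : Module.End K V) {p : Submodule K V}
    (hp : ∀ v ∈ p, f v ∈ p) (s : Finset ℤ) :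
    ∀ x : ℤ → V, (∀ n : ℤ, x n ∈ f.eigenspace (n : K)) → ∑ n ∈ s, x n ∈ p → ∀ n ∈ s, x n ∈ p := by
  induction s using Finset.induction_on with
  | empty => simp
  | insert a s ha ih =>
    intro x hx hsum
    have hs : ∀ n ∈ s, x n ∈ p := by
      intro n hn
      have hna : (n : K) - a ≠ 0 := by
        rw [sub_ne_zero]
        exact_mod_cast fun h : n = a => ha (h ▸ hn)
      -- Applying f - a to the sum kills the a-th term and scales the n-th by n - a ≠ 0, so the
      -- induction hypothesis applies to the scaled vectors.
      refine (p.smul_mem_iff hna).1 (ih (fun n => ((n : K) - a) • x n)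
        (fun n => Submodule.smul_mem _ _ (hx n)) ?_ n hn)
      have h := p.sub_mem (hp _ hsum) (p.smul_mem (a : K) hsum)
      rw [Finset.sum_insert ha] at h
      convert h using 1
      have hf : ∀ n : ℤ, f (x n) = (n : K) • x n := fun n => mem_eigenspace_iff.1 (hx n)
      simp only [map_add, map_sum, hf, smul_add, Finset.smul_sum, sub_smul,
        Finset.sum_sub_distrib]
      abel
    rw [Finset.sum_insert ha, p.add_mem_iff_left (p.sum_mem hs)] at hsum
    exact Finset.forall_mem_insert _ _ _ |>.2 ⟨hsum, hs⟩

theorem iSup_eigenspace_restrict_eq_top (f : Module.End K V) {p : Submodule K V}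
    (hp : ∀ v ∈ p, f v ∈ p) (hf : ⨆ n : ℤ, f.eigenspace (n : K) = ⊤) :
    ⨆ n : ℤ, eigenspace (f.restrict hp) (n : K) = ⊤ := by
  refine eq_top_iff.2 fun v _ => ?_
  obtain ⟨x, hx, hv⟩ := (Submodule.mem_iSup_iff_exists_finsupp _ _).1
    (hf ▸ Submodule.mem_top : (v : V) ∈ ⨆ n : ℤ, f.eigenspace (n : K))
  have hmem := f.mem_of_sum_eigenvectors_mem hp x.support x hx
    (by rw [show ∑ n ∈ x.support, x n = v from hv]; exact v.2)
  have hsum : v = ∑ n ∈ x.support.attach, (⟨x n, hmem n n.2⟩ : p) := by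
    refine Subtype.ext ?_
    rw [Submodule.coe_sum, ← hv, Finsupp.sum, ← Finset.sum_attach]
  rw [hsum]
  refine Submodule.sum_mem _ fun n _ => Submodule.mem_iSup_of_mem (n : ℤ) ?_
  exact mem_eigenspace_iff.2 (Subtype.ext (mem_eigenspace_iff.1 (hx n)))

end Module.End

/-! ### Commutators, commutants and Virasoro relations -/

namespace VertexAlgebra

variable {V : Type*} [AddCommGroup V] [Module ℂ V] (A : VertexAlgebra V)

/-- The product `(u, v) ↦ uₙ v` as a bilinear map. -/
noncomputable def modeBilin (n : ℤ) : V →ₗ[ℂ] V →ₗ[ℂ] V where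
  toFun u := A.mode u n
  map_add' u v := by simp [mode]
  map_smul' c u := by simp [mode]

theorem modeBilin_apply (n : ℤ) (u v : V) : A.modeBilin n u v = A.mode u n v := rfl

theorem mode_zero (n : ℤ) : A.mode 0 n = 0 := (A.modeBilin n).map_zero

theorem mode_sub (u v : V) (n : ℤ) : A.mode (u - v) n = A.mode u n - A.mode v n :=
  (A.modeBilin n).map_sub u v

theorem mode_smul (c : ℂ) (u : V) (n : ℤ) : A.mode (c • u) n = c • A.mode u n :=
  (A.modeBilin n).map_smul c u

theorem mode_vac (n : ℤ) : A.mode A.vac n = if n = -1 then 1 else 0 := by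
  ext v
  rw [mode, A.vacuum]
  split_ifs <;> rfl

theorem mode_apply_vac {n : ℤ} (hn : 0 ≤ n) (u : V) : A.mode u n A.vac = 0 :=
  A.creation_nonneg u n hn

theorem mode_neg_one_vac (u : V) : A.mode u (-1) A.vac = u := A.creation u

/-- The commutator formula. -/
theorem mode_commutator (u v w : V) (m n : ℤ) :
    A.mode u m (A.mode v n w) - A.mode v n (A.mode u m w) =
      ∑ᶠ i : ℕ, (Ring.choose m i : ℤ) • A.mode (A.mode u i v) (m + n - i) w := by
  have h := A.jacobi u v w 0 m n
  -- For l = 0 only the i = 0 terms on the left survive.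
  rw [finsum_eq_single _ 0 fun i hi => by
      rw [Ring.choose_zero_pos ℤ (Nat.pos_of_ne_zero hi)]; simp,
    finsum_eq_single _ 0 fun i hi => by
      rw [Ring.choose_zero_pos ℤ (Nat.pos_of_ne_zero hi)]; simp] at h
  simpa [mode] using h

/-- The commutant of a vector `x`: the vectors `u` such that `xₙ u = 0` for all `n ≥ 0`. -/
noncomputable def commutant (x : V) : A.Subalgebra where
  toSubmodule := ⨅ n : ℕ, LinearMap.ker (A.mode x n)
  vac_mem := by
    simpa [Submodule.mem_iInf] using fun n : ℕ => A.mode_apply_vac (Int.natCast_nonneg n) x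
  mode_mem u hu v hv n := by
    simp only [AddSubsemigroup.mem_carrier, AddSubmonoid.mem_toSubsemigroup,
      Submodule.mem_toAddSubmonoid, Submodule.mem_iInf, LinearMap.mem_ker] at hu hv ⊢
    intro k
    -- The commutator of x_k and u_n involves only modes of x_i u with i ≥ 0, all zero.
    have h := A.mode_commutator x u v k n
    simpa [hu, hv, mode_zero] using h

theorem mem_commutant {x u : V} :
    u ∈ (A.commutant x).toSubmodule ↔ ∀ n : ℕ, A.mode x n u = 0 := by
  simp [commutant, Submodule.mem_iInf]

theorem Subalgebra.coe_mode {A : VertexAlgebra V} (U : A.Subalgebra) (u v : U.toSubmodule) (n : ℤ) :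
    ((U.toVertexAlgebra.mode u n v : U.toSubmodule) : V) = A.mode u n v :=
  U.coe_ncoeff_YRestrict u v n

/-- The i = 3 term of the commutator formula carries this binomial; multiplied by c / 2 it gives the
central term. -/
theorem six_mul_choose_three (m : ℤ) : 6 * Ring.choose (m + 1) 3 = m ^ 3 - m := by
  have h := Ring.descPochhammer_eq_factorial_smul_choose (m + 1) 3
  simp only [descPochhammer_succ_right, descPochhammer_zero, Polynomial.smeval_mul,
    Polynomial.smeval_sub, Polynomial.smeval_one, Polynomial.smeval_X, Polynomial.smeval_natCast,
    Nat.factorial, nsmul_eq_mul] at h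
  push_cast at h
  linarith

/-- A vector whose nonnegative products with itself are those of a conformal vector has modes
satisfying the Virasoro relations. -/
theorem virasoro_of_products {x : V} {c : ℂ}
    (h0 : ∀ n : ℤ, A.mode (A.mode x 0 x) n = (-n : ℂ) • A.mode x (n - 1))
    (h1 : A.mode x 1 x = (2 : ℂ) • x) (h2 : A.mode x 2 x = 0)
    (h3 : A.mode x 3 x = (c / 2) • A.vac) (h4 : ∀ n : ℤ, 4 ≤ n → A.mode x n x = 0) (m n : ℤ) :
    A.L x m * A.L x n - A.L x n * A.L x m = ((m : ℂ) - (n : ℂ)) • A.L x (m + n)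
      + (if m + n = 0 then ((m : ℂ) ^ 3 - (m : ℂ)) / 12 * c else 0) • (1 : Module.End ℂ V) := by
  ext w
  have h := A.mode_commutator x x w (m + 1) (n + 1)
  rw [finsum_eq_sum_of_support_subset (s := Finset.range 4) _ ?_] at h
  · have hc : ((Ring.choose (m + 1) 3 : ℤ) : ℂ) = ((m : ℂ) ^ 3 - m) / 6 := by
      rw [eq_div_iff (by norm_num), mul_comm]
      exact_mod_cast six_mul_choose_three m
    simp only [Finset.sum_range_succ, Finset.sum_range_zero, zero_add, Nat.cast_zero, Nat.cast_one,
      Nat.cast_ofNat, Ring.choose_zero_right, Ring.choose_one_right, h0, h1, h2, h3, mode_smul,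
      mode_zero, mode_vac, ← Int.cast_smul_eq_zsmul ℂ, hc] at h
    simp only [L, LinearMap.sub_apply, Module.End.mul_apply, h, LinearMap.add_apply,
      LinearMap.smul_apply, LinearMap.zero_apply, smul_zero, add_zero,
      show m + 1 + (n + 1) - 0 - 1 = m + n + 1 by ring,
      show m + 1 + (n + 1) - 1 = m + n + 1 by ring,
      show m + 1 + (n + 1) - 3 = -1 ↔ m + n = 0 by omega]
    split_ifs <;> simp only [LinearMap.zero_apply, smul_zero, Module.End.one_apply] <;> push_cast <;>
      module
  · intro i hi
    by_contra hi'
    simp only [Finset.coe_range, Set.mem_Iio, not_lt] at hi'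
    exact hi (by simp [h4 i (by exact_mod_cast hi'), mode_zero])

namespace IsConformalVector

variable {A} {ω : V}

/-- The right side does not involve ω, so conformal vectors of V and of a subalgebra have the same
zeroth mode on the latter. -/
theorem mode_zero_apply (h : A.IsConformalVector ω) (u : V) :
    A.mode ω 0 u = A.mode u (-2) A.vac := by
  have := LinearMap.congr_fun (h.derivative u (-1)) A.vac
  rw [mode_neg_one_vac] at this
  simpa [L] using this

theorem mode_mode_zero (h : A.IsConformalVector ω) (u : V) (n : ℤ) :
    A.mode (A.mode ω 0 u) n = (-n : ℂ) • A.mode u (n - 1) :=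
  h.derivative u n

/-- The nonnegative products of a conformal vector with itself. -/
theorem exists_mode_self (h : A.IsConformalVector ω) : ∃ c : ℂ, ∀ n : ℤ, 0 ≤ n →
    A.mode ω n ω = ((n : ℂ) + 1) • A.mode ω (n - 2) A.vac
      + (if n = 3 then c / 2 else 0) • A.vac := by
  obtain ⟨c, hc⟩ := h.virasoro
  refine ⟨c, fun n hn => ?_⟩
  -- L(-2)1 = ω, while L(n-1)1 = 0 for n ≥ 0.
  have key := LinearMap.congr_fun (hc (n - 1) (-2)) A.vac
  simp only [L, LinearMap.sub_apply, Module.End.mul_apply, LinearMap.add_apply,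
    LinearMap.smul_apply, Module.End.one_apply, show n - 1 + 1 = n by ring,
    show (-2 : ℤ) + 1 = -1 by norm_num, mode_neg_one_vac, A.mode_apply_vac hn, map_zero, sub_zero,
    show n - 1 + -2 + 1 = n - 2 by ring, show n - 1 + -2 = 0 ↔ n = 3 by omega] at key
  rw [key]
  congr 1
  · push_cast
    congr 1
    ring
  · split_ifs with h3
    · subst h3
      congr 1
      push_cast
      ring
    · rfl

end IsConformalVector
end VertexAlgebra

/-! ### Equations for semi-conformal vectors -/

namespace VertexOperatorAlgebra

variable {V : Type*} [AddCommGroup V] [Module ℂ V] (A : VertexOperatorAlgebra V)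

theorem mem_weightSpace_two {x : V} :
    x ∈ A.weightSpace 2 ↔ A.mode A.ω 1 x = (2 : ℂ) • x := by
  simp [weightSpace, VertexAlgebra.weightSpace, VertexAlgebra.L]

variable {A}

theorem IsSemiConformal.equations {x : V} (hx : A.IsSemiConformal x) :
    x ∈ A.weightSpace 2 ∧ (∀ n : ℕ, A.mode x n x = A.mode A.ω n x) ∧ A.mode A.ω 2 x = 0 ∧
      A.mode A.ω 3 x ∈ Submodule.span ℂ {A.vac} ∧ ∀ n : ℕ, 4 ≤ n → A.mode A.ω n x = 0 := by
  obtain ⟨U, hU, hconf, hL⟩ := hx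
  obtain ⟨c, hc⟩ := hconf.exists_mode_self
  have hself : ∀ n : ℤ, 0 ≤ n → A.mode x n x = ((n : ℂ) + 1) • A.mode x (n - 2) A.vac
      + (if n = 3 then c / 2 else 0) • A.vac := by
    intro n hn
    have h := congrArg Subtype.val (hc n hn)
    rwa [Submodule.coe_add, Submodule.coe_smul, Submodule.coe_smul, U.coe_mode, U.coe_mode] at h
  have hprod : ∀ n : ℕ, A.mode x n x = A.mode A.ω n x := by
    -- The compatibility of L'(n) and L(n) for n ≥ 0 covers only modes of index at least 1; at index
    -- 0 both sides equal x_{-2}1.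
    rintro (_ | n)
    · have := hself 0 le_rfl
      rw [Nat.cast_zero, A.conformal.mode_zero_apply, this]
      simp
    · simpa [VertexAlgebra.L, U.coe_mode] using hL n (Int.natCast_nonneg n) ⟨x, hU⟩
  have hω : ∀ n : ℕ, A.mode A.ω n x = ((n : ℂ) + 1) • A.mode x ((n : ℤ) - 2) A.vac
      + (if (n : ℤ) = 3 then c / 2 else 0) • A.vac := fun n => by
    rw [← hprod, hself n (Int.natCast_nonneg n), Int.cast_natCast]
  refine ⟨A.mem_weightSpace_two.2 ?_, hprod, ?_, ?_, ?_⟩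
  · have := hω 1
    norm_num [A.mode_neg_one_vac] at this
    exact this
  · have := hω 2
    norm_num [A.mode_apply_vac] at this
    exact this
  · have := hω 3
    norm_num [A.mode_apply_vac] at this
    exact this ▸ Submodule.smul_mem _ _ (Submodule.mem_span_singleton_self _)
  · intro n hn
    rw [hω n, A.mode_apply_vac (by omega), if_neg (by omega)]
    simp

theorem isSemiConformal_of_equations {x : V} (h2 : x ∈ A.weightSpace 2)
    (hprod : ∀ n : ℕ, A.mode x n x = A.mode A.ω n x) (hω2 : A.mode A.ω 2 x = 0)
    (hω3 : A.mode A.ω 3 x ∈ Submodule.span ℂ {A.vac})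
    (hω4 : ∀ n : ℕ, 4 ≤ n → A.mode A.ω n x = 0) : A.IsSemiConformal x := by
  set U := A.commutant (A.ω - x) with hUdef
  have hmem : ∀ u : V, u ∈ U.toSubmodule ↔ ∀ n : ℕ, A.mode x n u = A.mode A.ω n u := fun u => by
    rw [hUdef, A.mem_commutant]
    simp only [A.mode_sub, LinearMap.sub_apply, sub_eq_zero]
    exact forall_congr' fun _ => eq_comm
  have hx : x ∈ U.toSubmodule := (hmem x).2 hprod
  obtain ⟨c, hc⟩ := Submodule.mem_span_singleton.1 hω3
  -- The third product is half the central charge times the vacuum, hence the charge 2c.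
  have hvir := A.virasoro_of_products (x := x) (c := 2 * c)
    (fun n => by
      rw [show A.mode x 0 x = A.mode A.ω 0 x from hprod 0, A.conformal.mode_mode_zero])
    ((hprod 1).trans (A.mem_weightSpace_two.1 h2)) ((hprod 2).trans hω2)
    (by rw [mul_div_cancel_left₀ _ two_ne_zero]; exact (hprod 3).trans hc.symm)
    (fun n hn => by
      lift n to ℕ using by omega
      rw [hprod, hω4 n (by omega)])
  have hcoe : ∀ (n : ℤ) (u : U.toSubmodule),
      ((U.toVertexAlgebra.L ⟨x, hx⟩ n u : U.toSubmodule) : V) = A.L x n u :=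
    fun n u => U.coe_mode ⟨x, hx⟩ u (n + 1)
  -- The agreement starts at L(-1), which the derivative property needs.
  have hL : ∀ n : ℤ, 0 ≤ n + 1 → ∀ u : U.toSubmodule, A.L x n u = A.L A.ω n u := by
    intro n hn u
    obtain ⟨k, hk⟩ := Int.eq_ofNat_of_zero_le hn
    simpa [VertexAlgebra.L, hk] using (hmem u).1 u.2 k
  have hinv : ∀ u ∈ U.toSubmodule, A.L A.ω 0 u ∈ U.toSubmodule := fun u hu => by
    rw [← hL 0 (by norm_num) ⟨u, hu⟩]
    exact U.mode_mem x hx u hu _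
  have hL0 : U.toVertexAlgebra.L ⟨x, hx⟩ 0 = (A.L A.ω 0).restrict hinv :=
    LinearMap.ext fun u => Subtype.ext ((hcoe 0 u).trans (hL 0 (by norm_num) u))
  have hws : ∀ n : ℤ, U.toVertexAlgebra.weightSpace ⟨x, hx⟩ n =
      (A.weightSpace n).comap U.toSubmodule.subtype := fun n => by
    ext u
    simp [weightSpace, VertexAlgebra.weightSpace, hL0, Subtype.ext_iff]
  refine ⟨U, hx, ⟨⟨2 * c, fun m n => LinearMap.ext fun u => Subtype.ext ?_⟩,
    fun u n => LinearMap.ext fun v => Subtype.ext ?_, ?_, fun n => ?_, ?_⟩,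
    fun n hn u => (hcoe n u).trans (hL n (by omega) u)⟩
  · have h := LinearMap.congr_fun (hvir m n) (u : V)
    simp only [LinearMap.sub_apply, LinearMap.add_apply, LinearMap.smul_apply,
      Module.End.mul_apply, Module.End.one_apply, Submodule.coe_sub, Submodule.coe_add,
      Submodule.coe_smul, hcoe] at h ⊢
    exact h
  · have h := LinearMap.congr_fun (A.conformal.derivative u n) v
    rw [← hL (-1) (by norm_num) u, ← hcoe] at h
    simpa [U.coe_mode] using h
  · have hind := (Module.End.eigenspaces_iSupIndep (U.toVertexAlgebra.L ⟨x, hx⟩ 0)).comp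
      (Int.cast_injective (α := ℂ))
    refine DirectSum.isInternal_submodule_of_iSupIndep_of_iSup_eq_top hind ?_
    have htop := A.conformal.graded.submodule_iSup_eq_top
    unfold VertexAlgebra.weightSpace
    rw [hL0]
    exact Module.End.iSup_eigenspace_restrict_eq_top _ hinv htop
  · have : FiniteDimensional ℂ (A.weightSpace n) := A.conformal.finite n
    rw [hws]
    let f : (A.weightSpace n).comap U.toSubmodule.subtype →ₗ[ℂ] A.weightSpace n :=
      U.toSubmodule.subtype.restrict fun _ hu => hu
    exact Module.Finite.of_injective f fun a b hab =>
      Subtype.ext (Subtype.ext (congrArg (fun w : A.weightSpace n => (w : V)) hab))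
  · obtain ⟨N, hN⟩ := A.conformal.bounded
    refine ⟨N, fun n hn => ?_⟩
    rw [hws, show A.weightSpace n = ⊥ from hN n hn, Submodule.comap_bot, Submodule.ker_subtype]

theorem mem_Sc_iff {x : V} (h2 : x ∈ A.weightSpace 2) :
    x ∈ A.Sc ↔ (∀ n : ℕ, A.mode x n x = A.mode A.ω n x) ∧ A.mode A.ω 2 x = 0 ∧
      A.mode A.ω 3 x ∈ Submodule.span ℂ {A.vac} ∧ ∀ n : ℕ, 4 ≤ n → A.mode A.ω n x = 0 :=
  ⟨fun h => (IsSemiConformal.equations h).2,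
    fun ⟨hp, h₂, h₃, h₄⟩ => isSemiConformal_of_equations h2 hp h₂ h₃ h₄⟩

end VertexOperatorAlgebra

/-! ### Zariski closed sets from quadratic equations -/

namespace IsZariskiClosed

variable {E W : Type*} [AddCommGroup E] [Module ℂ E] [FiniteDimensional ℂ E]
  [AddCommGroup W] [Module ℂ W]

theorem iInter {ι : Sort*} {S : ι → Set E} (hS : ∀ i, IsZariskiClosed (S i)) :
    IsZariskiClosed (⋂ i, S i) := by
  refine ⟨inferInstance, fun d b => ?_⟩
  choose I hI using fun i => (hS i).2 d b
  refine ⟨Ideal.span {p | ∃ i, p ∈ I i}, ?_⟩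
  rw [MvPolynomial.zeroLocus_span, Set.image_iInter b.equivFun.bijective]
  ext t
  simp only [hI, Set.mem_iInter, MvPolynomial.mem_zeroLocus_iff, Set.mem_ofPred_eq]
  exact ⟨fun h p ⟨i, hp⟩ => h i p hp, fun h i p hp => h p ⟨i, hp⟩⟩

theorem inter {S T : Set E} (hS : IsZariskiClosed S) (hT : IsZariskiClosed T) :
    IsZariskiClosed (S ∩ T) := by
  rw [Set.inter_eq_iInter]
  exact iInter (by simp [hS, hT])

/-- The zero set of a quadratic function without constant term is Zariski closed. -/
theorem setOf_bilin_add_linear_eq_zero (B : E →ₗ[ℂ] E →ₗ[ℂ] W) (f : E →ₗ[ℂ] W) :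
    IsZariskiClosed {x | B x x + f x = 0} := by
  refine ⟨inferInstance, fun d b => ?_⟩
  -- One polynomial per functional on W: functionals separate points, so W need not be
  -- finite-dimensional.
  let p : Module.Dual ℂ W → MvPolynomial (Fin d) ℂ := fun φ =>
    ∑ i, ∑ j, MvPolynomial.C (φ (B (b i) (b j))) * (MvPolynomial.X i * MvPolynomial.X j)
      + ∑ i, MvPolynomial.C (φ (f (b i))) * MvPolynomial.X i
  have hp : ∀ φ x, MvPolynomial.aeval (b.equivFun x) (p φ) = φ (B x x + f x) := by
    intro φ x
    conv_rhs => rw [← b.sum_equivFun x]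
    simp only [p, map_add, map_sum, map_mul, MvPolynomial.aeval_C, MvPolynomial.aeval_X, map_smul,
      LinearMap.sum_apply, LinearMap.smul_apply, smul_eq_mul, Algebra.algebraMap_self,
      RingHom.id_apply]
    congr 1
    · simp only [Finset.mul_sum]
      rw [Finset.sum_comm]
      exact Finset.sum_congr rfl fun i _ => Finset.sum_congr rfl fun j _ => by ring
    · exact Finset.sum_congr rfl fun i _ => mul_comm _ _
  refine ⟨Ideal.span (Set.range p), ?_⟩
  rw [MvPolynomial.zeroLocus_span]
  ext t
  obtain ⟨x, rfl⟩ := b.equivFun.surjective t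
  rw [b.equivFun.injective.mem_set_image]
  simp only [Set.mem_ofPred_eq, Set.forall_mem_range, hp, Module.forall_dual_apply_eq_zero_iff]

theorem setOf_linear_eq_zero (f : E →ₗ[ℂ] W) : IsZariskiClosed {x | f x = 0} := by
  simpa using setOf_bilin_add_linear_eq_zero 0 f

end IsZariskiClosed

theorem theorem1p1 {V : Type*} [AddCommGroup V] [Module ℂ V] (A : VertexOperatorAlgebra V) :
    A.Sc ⊆ (A.weightSpace 2 : Set V) ∧
      IsZariskiClosed {x : A.weightSpace 2 | (x : V) ∈ A.Sc} := by
  refine ⟨fun x hx => hx.equations.1, ?_⟩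
  have : FiniteDimensional ℂ (A.weightSpace 2) := A.conformal.finite 2
  let ι := (A.weightSpace 2).subtype
  -- Passing to the quotient by ℂ·1 makes the condition on ω_3 x a linear equation.
  have hset : {x : A.weightSpace 2 | (x : V) ∈ A.Sc} =
      (⋂ n : ℕ, {x | (A.modeBilin n).compl₁₂ ι ι x x + (-(A.mode A.ω n ∘ₗ ι)) x = 0}) ∩
      ({x | (A.mode A.ω 2 ∘ₗ ι) x = 0} ∩
      ({x | ((Submodule.span ℂ {A.vac}).mkQ ∘ₗ A.mode A.ω 3 ∘ₗ ι) x = 0} ∩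
      ⋂ n : ℕ, ⋂ _ : 4 ≤ n, {x | (A.mode A.ω n ∘ₗ ι) x = 0})) := by
    ext x
    simp [VertexOperatorAlgebra.mem_Sc_iff x.2, ι, VertexAlgebra.modeBilin_apply,
      ← sub_eq_add_neg, sub_eq_zero]
  rw [hset]
  exact .inter (.iInter fun n => .setOf_bilin_add_linear_eq_zero _ _)
    (.inter (.setOf_linear_eq_zero _) (.inter (.setOf_linear_eq_zero _)
      (.iInter fun n => .iInter fun _ => .setOf_linear_eq_zero _)))
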